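/- Let $T$ be a finitary monad on $\mathbf{Set}$ (its functor part preserves filtered colimits), with unit $\eta$, let $\mathcal{A}=\mathbf{Set}^T$ be its category of Eilenberg–Moore algebras, and let $F:\mathcal{A}\to\mathcal{A}$ be a functor that preserves filtered colimits and preserves surjective $T$-algebra morphisms. An $F$-coalgebra is a pair $(A,a)$ with $a:A\to FA$ in $\mathcal{A}$; a morphism $(A,a)\to(B,b)$ is an $h:A\to B$ in $\mathcal A$ with $b\cdot h=Fh\cdot a$. Let $\mathsf{Coa}\,F$ be the category of $F$-coalgebras and $\mathsf{Coa}_{\mathrm{ffg}}F$ its full subcategory of coalgebras $c:TX\to FTX$ carried by the free $T$-algebra $TX$ on a finite set $X$. Elements $x$ of $(A,a)$ and $y$ of $(B,b)$ are *behaviourally equivalent* if $f(x)=g(y)$ for some coalgebra morphisms $f:(A,a)\to(E,e)$, $g:(B,b)\to(E,e)$ into a common coalgebra. The functor $F$ is *proper* if for all $(TX,c)$, $(TY,d)$ in $\mathsf{Coa}_{\mathrm{ffg}}F$ and all $x\in X$, $y\in Y$ such that $\eta_X(x)$ and $\eta_Y(y)$ are behaviourally equivalent, there is a zig-zag $TX=Z_0\to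 Z_1\leftarrow Z_2\to\cdots\leftarrow Z_n=TY$ of coalgebra morphisms in $\mathsf{Coa}_{\mathrm{ffg}}F$, from $(TX,c)$ to $(TY,d)$, together with elements $z_i\in Z_i$, $z_0=\eta_X(x)$, $z_n=\eta_Y(y)$, such that each morphism of the zig-zag maps the chosen element of its domain to the chosen element of its codomain. An $F$-coalgebra is *locally finitely presentable* (locally fp) if it is the colimit in $\mathsf{Coa}\,F$ of a small filtered diagram of coalgebras whose carriers are finitely presentable objects of $\mathcal{A}$. A *final locally fp coalgebra* is a locally fp coalgebra $(R,r)$ such that every locally fp coalgebra has a unique coalgebra morphism into $(R,r)$. **Statement.** Suppose that $F$ is proper. Then an $F$-coalgebra $(R,r)$ is a final locally fp coalgebra if and only if $(R,r)$ is locally fp and for every coalgebra $(TX,c)$ in $\mathsf{Coa}_{\mathrm{ffg}}F$ there exists a unique $F$-coalgebra morphism from $(TX,c)$ to $(R,r)$. -/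

import Mathlib

open CategoryTheory CategoryTheory.Limits

universe u

/-- `F` preserves surjective `T`-algebra morphisms. -/
def PreservesSurjections {T : Monad (Type u)} (F : T.Algebra ⥤ T.Algebra) : Prop :=
  ∀ ⦃A B : T.Algebra⦄ (h : A ⟶ B), Function.Surjective h.f → Function.Surjective (F.map h).f

/-- Behavioural equivalence of an element `x` of the coalgebra `C` and an element `y` of the
coalgebra `D`: some pair of coalgebra morphisms into a common coalgebra identifies them. -/
def BehaviourallyEquivalent {T : Monad (Type u)} {F : T.Algebra ⥤ T.Algebra}
    {C D : Endofunctor.Coalgebra F} (x : C.V.A) (y : D.V.A) : Prop :=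
  ∃ (E : Endofunctor.Coalgebra F) (f : C ⟶ E) (g : D ⟶ E), f.f.f x = g.f.f y

/-- A coalgebra `c : TX ⟶ F(TX)` whose carrier is the free `T`-algebra on a finite set `X`. -/
structure FfgCoalgebra {T : Monad (Type u)} (F : T.Algebra ⥤ T.Algebra) where
  /-- the set of free generators -/
  X : Type u
  finite : Finite X
  /-- the coalgebra structure -/
  c : T.free.obj X ⟶ F.obj (T.free.obj X)

namespace FfgCoalgebra

/-- The underlying `F`-coalgebra. Coalgebras with free finitely generated carrier form a full
subcategory of all coalgebras: their morphisms are the morphisms of underlying coalgebras. -/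
def toCoalgebra {T : Monad (Type u)} {F : T.Algebra ⥤ T.Algebra} (C : FfgCoalgebra F) :
    Endofunctor.Coalgebra F where
  V := T.free.obj C.X
  str := C.c

/-- The element `η_X(x)` of `TX` given by a generator `x`. -/
def gen {T : Monad (Type u)} {F : T.Algebra ⥤ T.Algebra} (C : FfgCoalgebra F) (x : C.X) :
    C.toCoalgebra.V.A :=
  T.η.app C.X x

end FfgCoalgebra

/-- There is a zig-zag `Z₀ ⟶ Z₁ ⟵ Z₂ ⟶ ⋯ ⟵ Zₙ` of coalgebra morphisms between coalgebras with free
finitely generated carrier which relates `z₀ ∈ Z₀` and `zₙ ∈ Zₙ`, i.e. there are `zᵢ ∈ Zᵢ` such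
that every morphism of the zig-zag maps the chosen element of its domain to the chosen element of
its codomain. -/
inductive RelatedByZigZag {T : Monad (Type u)} {F : T.Algebra ⥤ T.Algebra} :
    (C D : FfgCoalgebra F) → C.toCoalgebra.V.A → D.toCoalgebra.V.A → Prop
  | refl (C : FfgCoalgebra F) (x : C.toCoalgebra.V.A) : RelatedByZigZag C C x x
  | step {C W C' D : FfgCoalgebra F} (f : C.toCoalgebra ⟶ W.toCoalgebra)
      (g : C'.toCoalgebra ⟶ W.toCoalgebra) {x : C.toCoalgebra.V.A} {x' : C'.toCoalgebra.V.A}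
      {y : D.toCoalgebra.V.A} (h : f.f.f x = g.f.f x') (t : RelatedByZigZag C' D x' y) :
      RelatedByZigZag C D x y

/-- Proper functors. -/
def IsProper {T : Monad (Type u)} (F : T.Algebra ⥤ T.Algebra) : Prop :=
  ∀ (C D : FfgCoalgebra F) (x : C.X) (y : D.X),
    BehaviourallyEquivalent (C.gen x) (D.gen y) → RelatedByZigZag C D (C.gen x) (D.gen y)

/-- Locally finitely presentable coalgebras: the colimits, in the category of `F`-coalgebras, of
small filtered diagrams of coalgebras with finitely presentable carrier. -/
def IsLocallyFp {T : Monad (Type u)} {F : T.Algebra ⥤ T.Algebra}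
    (R : Endofunctor.Coalgebra F) : Prop :=
  ∃ (J : Type u) (_ : SmallCategory J) (_ : IsFiltered J) (D : J ⥤ Endofunctor.Coalgebra F)
    (ι : D ⟶ (Functor.const J).obj R),
    (∀ j, IsFinitelyPresentable.{u} (D.obj j).V) ∧ Nonempty (IsColimit (Cocone.mk R ι))

/-- Final locally finitely presentable coalgebras: the terminal objects of the full subcategory of
locally finitely presentable coalgebras. -/
def IsFinalLocallyFp {T : Monad (Type u)} {F : T.Algebra ⥤ T.Algebra}
    (R : Endofunctor.Coalgebra F) : Prop :=
  IsLocallyFp R ∧ ∀ A : Endofunctor.Coalgebra F, IsLocallyFp A → Nonempty (Unique (A ⟶ R))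

/-!
If `R` is final among locally fp coalgebras, it receives a unique morphism from every coalgebra on
`TX` with `X` finite, because `TX` is a finitely presentable algebra (`isFinitelyPresentable_free`:
the forgetful functor preserves filtered colimits as `T` does).

Conversely, morphisms out of a colimit are compatible families of morphisms, so it suffices to find
a unique morphism to `R` from every coalgebra `A` with finitely presentable carrier. Such a carrier
is the filtered colimit of its finitely generated subalgebras, hence is finitely generated itself:
there is a surjection `q : TX ⟶ A` with `X` finite (`exists_surjective_free`). As `F` preserves
surjections and `TX` is projective, `TX` has a coalgebra structure making `q` a coalgebra morphism
(`exists_coalgebra_lift`). Uniqueness for `A` follows since `q` is epi. For existence, the morphism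
`h : TX ⟶ R` must identify `s` and `t` whenever `q` does (`map_eq_of_map_eq`). Properness only
concerns generators, so `s` and `t` are first exhibited as images of generators of coalgebras on
`T(X + 1)` (`exists_gen_map_eq`); these generators are behaviourally equivalent, hence related by a
zig-zag, and by uniqueness the morphisms to `R` are compatible with zig-zags
(`RelatedByZigZag.map_eq`).
-/

/-! ### Free algebras -/

/-- Free algebras are projective with respect to surjective algebra morphisms. -/
theorem exists_lift_of_surjective {T : Monad (Type u)} {X : Type u} {A B : T.Algebra}
    (q : B ⟶ A) (hq : Function.Surjective q.f) (g : T.free.obj X ⟶ A) :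
    ∃ g' : T.free.obj X ⟶ B, g' ≫ q = g := by
  refine ⟨(T.adj.homEquiv X B).symm
    (↾fun x => Function.surjInv hq (T.adj.homEquiv X A g x)), ?_⟩
  rw [← Adjunction.homEquiv_naturality_right_symm, Equiv.symm_apply_eq]
  ext x
  exact Function.surjInv_eq hq _

/-- An algebra morphism which is constant on the fibres of a surjective algebra morphism factors
through it. -/
theorem exists_desc_of_surjective {T : Monad (Type u)} {A B R : T.Algebra}
    (q : B ⟶ A) (hq : Function.Surjective q.f) (h : B ⟶ R)
    (H : ∀ s t, q.f s = q.f t → h.f s = h.f t) : ∃ h' : A ⟶ R, q ≫ h' = h := by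
  have : Epi q.f := (epi_iff_surjective _).2 hq
  have : IsSplitEpi q.f := isSplitEpi_of_epi _
  have fac : q.f ≫ (↾fun y => h.f (Function.surjInv hq y)) = h.f := by
    ext s
    exact H _ _ (Function.surjInv_eq hq _)
  refine ⟨⟨↾fun y => h.f (Function.surjInv hq y), ?_⟩, ?_⟩
  · -- `T.map q.f` is still epi, being the image of a split epimorphism
    rw [← cancel_epi (T.map q.f), ← Category.assoc, ← T.map_comp, fac, h.h, q.h_assoc, fac]
  · ext1
    exact fac

theorem epi_of_surjective {T : Monad (Type u)} {A B : T.Algebra}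
    (q : B ⟶ A) (hq : Function.Surjective q.f) : Epi q :=
  T.forget.epi_of_epi_map ((epi_iff_surjective _).2 hq)

theorem isFinitelyPresentable_free {T : Monad (Type u)}
    (hT : PreservesFilteredColimits T.toFunctor) (X : Type u) [Finite X] :
    IsFinitelyPresentable.{u} (T.free.obj X) := by
  have : Fact Cardinal.aleph0.{u}.IsRegular := ⟨Cardinal.isRegular_aleph0⟩
  have : IsCardinalPresentable X Cardinal.aleph0.{u} :=
    (hasCardinalLT_of_finite X _ le_rfl).isCardinalPresentable
  have : PreservesFilteredColimitsOfSize.{u, u} T.forget :=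
    ⟨fun J _ _ => by
      have := hT.preserves_filtered_colimits J
      infer_instance⟩
  have : T.forget.IsCardinalAccessible Cardinal.aleph0.{u} :=
    Functor.IsFinitelyAccessible_iff_preservesFilteredColimitsOfSize.2 this
  exact T.adj.isCardinalPresentable_leftAdjoint_obj _ X

/-! ### Finitely presentable algebras are quotients of finitely generated free algebras -/

/-- A subset `S` of an algebra is closed if the structure map sends `T S` into `S`. -/
def IsClosedSubset {T : Monad (Type u)} (A : T.Algebra) (S : Set A.A) : Prop :=
  ∀ z : T.obj S, A.a (T.map (↾(Subtype.val : S → A.A)) z) ∈ S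

/-- The subalgebra carried by a closed subset. -/
def subalgebra {T : Monad (Type u)} (A : T.Algebra) (S : Set A.A) (hS : IsClosedSubset A S) :
    T.Algebra where
  A := S
  a := ↾fun z => (⟨A.a (T.map (↾(Subtype.val : S → A.A)) z), hS z⟩ : S)
  unit := by
    have hm : Mono (↾(Subtype.val : S → A.A)) := (mono_iff_injective _).2 Subtype.val_injective
    rw [← cancel_mono (↾(Subtype.val : S → A.A))]
    change T.η.app S ≫ T.map (↾(Subtype.val : S → A.A)) ≫ A.a = _
    rw [← T.η.naturality_assoc, A.unit]
    rfl
  assoc := by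
    have hm : Mono (↾(Subtype.val : S → A.A)) := (mono_iff_injective _).2 Subtype.val_injective
    rw [← cancel_mono (↾(Subtype.val : S → A.A)), Category.assoc, Category.assoc]
    change T.μ.app S ≫ T.map (↾(Subtype.val : S → A.A)) ≫ A.a =
      T.map _ ≫ T.map (↾(Subtype.val : S → A.A)) ≫ A.a
    rw [← T.μ.naturality_assoc, A.assoc, ← T.map_comp_assoc]
    change T.map (T.map _) ≫ _ = T.map (T.map (↾(Subtype.val : S → A.A)) ≫ A.a) ≫ A.a
    rw [T.map_comp, Category.assoc]

/-- The inclusion of a subalgebra. -/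
def subalgebraIncl {T : Monad (Type u)} (A : T.Algebra) (S : Set A.A)
    (hS : IsClosedSubset A S) : subalgebra A S hS ⟶ A where
  f := ↾(Subtype.val : S → A.A)
  h := rfl

/-- The inclusion between two nested subalgebras. -/
def subalgebraMap {T : Monad (Type u)} (A : T.Algebra) {S S' : Set A.A}
    (hS : IsClosedSubset A S) (hS' : IsClosedSubset A S') (h : S ⊆ S') :
    subalgebra A S hS ⟶ subalgebra A S' hS' where
  f := ↾(Set.inclusion h)
  h := by
    have key : T.map (↾(Set.inclusion h)) ≫ T.map (↾(Subtype.val : S' → A.A)) ≫ A.a =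
        T.map (↾(Subtype.val : S → A.A)) ≫ A.a := by
      rw [← T.map_comp_assoc]
      rfl
    ext x
    have hx := ConcreteCategory.congr_hom key x
    exact Subtype.ext hx

/-- The range of an algebra morphism is closed. -/
theorem isClosedSubset_range {T : Monad (Type u)} {A B : T.Algebra} (f : B ⟶ A) :
    IsClosedSubset A (Set.range f.f) := by
  intro z
  let e : B.A ⟶ Set.range f.f := ↾Set.rangeFactorization f.f
  have : Epi e := (epi_iff_surjective _).2 Set.rangeFactorization_surjective
  have : IsSplitEpi e := isSplitEpi_of_epi _
  obtain ⟨w, rfl⟩ := (epi_iff_surjective (T.map e)).1 inferInstance z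
  exact ⟨B.a w, (ConcreteCategory.congr_hom f.h w).symm.trans
    (congrArg A.a (ConcreteCategory.congr_hom (T.map_comp e (↾Subtype.val)) w))⟩

/-- The algebra morphism `T S ⟶ A` extending the inclusion of a subset `S` of `A`. -/
def spanHom {T : Monad (Type u)} (A : T.Algebra) (S : Set A.A) : T.free.obj S ⟶ A :=
  (T.adj.homEquiv S A).symm (↾(Subtype.val : S → A.A))

theorem η_spanHom {T : Monad (Type u)} (A : T.Algebra) (S : Set A.A) (x : S) :
    (spanHom A S).f (T.η.app S x) = x.1 :=
  ConcreteCategory.congr_hom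
    ((T.adj.homEquiv S A).apply_symm_apply (↾(Subtype.val : S → A.A))) x

theorem range_spanHom_mono {T : Monad (Type u)} (A : T.Algebra) {S S' : Set A.A} (h : S ⊆ S') :
    Set.range (spanHom A S).f ⊆ Set.range (spanHom A S').f := by
  have fac : T.free.map (↾(Set.inclusion h)) ≫ spanHom A S' = spanHom A S := by
    rw [spanHom, spanHom, ← Adjunction.homEquiv_naturality_left_symm]
    rfl
  rintro _ ⟨z, rfl⟩
  exact ⟨(T.free.map (↾(Set.inclusion h))).f z,
    ConcreteCategory.congr_hom (congrArg Monad.Algebra.Hom.f fac) z⟩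

/-- The directed diagram of the subalgebras of `A` generated by finite subsets. -/
def spanFunctor {T : Monad (Type u)} (A : T.Algebra) : Finset A.A ⥤ T.Algebra where
  obj S := subalgebra A _ (isClosedSubset_range (spanHom A S))
  map h := subalgebraMap A _ _ (range_spanHom_mono A (by exact_mod_cast leOfHom h))
  map_id _ := rfl
  map_comp _ _ := rfl

/-- The inclusions of the finitely generated subalgebras. -/
def spanCocone {T : Monad (Type u)} (A : T.Algebra) : Cocone (spanFunctor A) where
  pt := A
  ι :=
    { app := fun S => subalgebraIncl A _ (isClosedSubset_range (spanHom A S))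
      naturality := fun _ _ _ => rfl }

/-- Every algebra is the directed colimit of its finitely generated subalgebras. -/
theorem nonempty_isColimit_spanCocone {T : Monad (Type u)}
    (hT : PreservesFilteredColimits T.toFunctor) (A : T.Algebra) :
    Nonempty (IsColimit (spanCocone A)) := by
  classical
  have := hT.preserves_filtered_colimits (Finset A.A)
  -- the forgetful functor creates, hence reflects, filtered colimits
  refine ⟨isColimitOfReflects T.forget (Types.FilteredColimit.isColimitOf' _ _ ?_ ?_)⟩
  · intro x
    -- `x` lies in the subalgebra generated by `{x}`
    exact ⟨{x}, ⟨x, T.η.app _ ⟨x, Finset.mem_coe.2 (Finset.mem_singleton_self x)⟩,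
      η_spanHom A _ _⟩, rfl⟩
  · intro S x y h
    exact ⟨S, 𝟙 S, Subtype.ext h⟩

/-- The identity of a finitely presentable algebra factors through one of its finitely generated
subalgebras, which is then the whole algebra. -/
theorem exists_surjective_free {T : Monad (Type u)}
    (hT : PreservesFilteredColimits T.toFunctor) (A : T.Algebra)
    (hA : IsFinitelyPresentable.{u} A) :
    ∃ (X : Type u) (_ : Finite X) (q : T.free.obj X ⟶ A), Function.Surjective q.f := by
  classical
  obtain ⟨hc⟩ := nonempty_isColimit_spanCocone hT A
  obtain ⟨S, p, hp⟩ := IsFinitelyPresentable.exists_hom_of_isColimit hc (𝟙 A)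
  refine ⟨(S : Set A.A), inferInstance, spanHom A S, fun x => ?_⟩
  obtain ⟨z, hz⟩ := (p.f x).2
  have hx := ConcreteCategory.congr_hom (congrArg Monad.Algebra.Hom.f hp) x
  exact ⟨z, hz.trans hx⟩

/-! ### Coalgebras with free finitely generated carrier -/

/-- A coalgebra with finitely presentable carrier is the colimit of the diagram on a single object
with value itself. -/
theorem isLocallyFp_of_isFinitelyPresentable {T : Monad (Type u)} {F : T.Algebra ⥤ T.Algebra}
    (A : Endofunctor.Coalgebra F) (hA : IsFinitelyPresentable.{u} A.V) : IsLocallyFp A :=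
  ⟨Discrete PUnit, inferInstance, inferInstance, (Functor.const _).obj A, 𝟙 _, fun _ => hA,
    ⟨{ desc := fun s => s.ι.app ⟨⟨⟩⟩
       fac := fun _ _ => Category.id_comp _
       uniq := fun _ m h => (Category.id_comp m).symm.trans (h ⟨⟨⟩⟩) }⟩⟩

/-- Every coalgebra structure lifts along a surjection from a free algebra, since `F` preserves
surjections and free algebras are projective. -/
theorem exists_coalgebra_lift {T : Monad (Type u)} {F : T.Algebra ⥤ T.Algebra}
    (hsurj : PreservesSurjections F) (A : Endofunctor.Coalgebra F) (X : Type u) [Finite X]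
    (q : T.free.obj X ⟶ A.V) (hq : Function.Surjective q.f) :
    ∃ (c : T.free.obj X ⟶ F.obj (T.free.obj X))
      (f : (FfgCoalgebra.mk X inferInstance c).toCoalgebra ⟶ A), f.f = q := by
  obtain ⟨c, hc⟩ := exists_lift_of_surjective (F.map q) (hsurj q hq) (q ≫ A.str)
  exact ⟨c, ⟨q, hc⟩, rfl⟩

/-- Every element `s` of a coalgebra `C` carried by `TX` is the image of a generator under a
coalgebra morphism into `C`: adjoin to `X` a new generator that is sent to `s`. -/
theorem exists_gen_map_eq {T : Monad (Type u)} {F : T.Algebra ⥤ T.Algebra}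
    (hsurj : PreservesSurjections F) (C : FfgCoalgebra F) (s : C.toCoalgebra.V.A) :
    ∃ (C' : FfgCoalgebra F) (x : C'.X) (f : C'.toCoalgebra ⟶ C.toCoalgebra),
      f.f.f (C'.gen x) = s := by
  have := C.finite
  let φ : Option C.X ⟶ C.toCoalgebra.V.A := ↾fun o => o.elim s C.gen
  let q : T.free.obj (Option C.X) ⟶ C.toCoalgebra.V := (T.adj.homEquiv _ _).symm φ
  have hφ : ∀ o, q.f (T.η.app _ o) = φ o :=
    ConcreteCategory.congr_hom ((T.adj.homEquiv _ C.toCoalgebra.V).apply_symm_apply φ)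
  have fac : T.free.map (↾(some : C.X → Option C.X)) ≫ q = 𝟙 _ := by
    apply (T.adj.homEquiv _ _).injective
    refine (T.adj.homEquiv_naturality_left _ _).trans ?_
    refine (congrArg (_ ≫ ·) ((T.adj.homEquiv _ C.toCoalgebra.V).apply_symm_apply φ)).trans ?_
    exact (T.adj.homEquiv_id _).symm
  have hq : Function.Surjective q.f := fun t =>
    ⟨_, ConcreteCategory.congr_hom (congrArg Monad.Algebra.Hom.f fac) t⟩
  obtain ⟨c, f, hf⟩ := exists_coalgebra_lift hsurj C.toCoalgebra (Option C.X) q hq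
  refine ⟨⟨_, inferInstance, c⟩, none, f, ?_⟩
  rw [hf]
  exact hφ none

/-- Morphisms into a coalgebra `R` which receives exactly one morphism from every coalgebra with
free finitely generated carrier are compatible with zig-zags. -/
theorem RelatedByZigZag.map_eq {T : Monad (Type u)} {F : T.Algebra ⥤ T.Algebra}
    {R : Endofunctor.Coalgebra F}
    (H : ∀ C : FfgCoalgebra F, Nonempty (Unique (C.toCoalgebra ⟶ R)))
    {C D : FfgCoalgebra F} {x : C.toCoalgebra.V.A} {y : D.toCoalgebra.V.A}
    (hxy : RelatedByZigZag C D x y) (f : C.toCoalgebra ⟶ R) (g : D.toCoalgebra ⟶ R) :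
    f.f.f x = g.f.f y := by
  have hsub : ∀ (C : FfgCoalgebra F) (k l : C.toCoalgebra ⟶ R), k = l := fun C k l =>
    let ⟨_⟩ := H C
    Subsingleton.elim k l
  induction hxy with
  | refl C x => rw [hsub C f g]
  | @step C W C' D k l x x' y h t ih =>
    obtain ⟨u⟩ := H W
    rw [hsub C f (k ≫ u.default), ← ih (l ≫ u.default) g]
    exact congrArg u.default.f.f h

/-- Properness makes the morphism from `TX` to `R` identify all elements that some coalgebra
morphism identifies. -/
theorem map_eq_of_map_eq {T : Monad (Type u)} {F : T.Algebra ⥤ T.Algebra}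
    (hsurj : PreservesSurjections F) (hproper : IsProper F) {R : Endofunctor.Coalgebra F}
    (H : ∀ C : FfgCoalgebra F, Nonempty (Unique (C.toCoalgebra ⟶ R)))
    {A : Endofunctor.Coalgebra F} (C : FfgCoalgebra F) (q : C.toCoalgebra ⟶ A)
    (h : C.toCoalgebra ⟶ R) (s t : C.toCoalgebra.V.A) (hst : q.f.f s = q.f.f t) :
    h.f.f s = h.f.f t := by
  obtain ⟨C₁, x, f, rfl⟩ := exists_gen_map_eq hsurj C s
  obtain ⟨C₂, y, g, rfl⟩ := exists_gen_map_eq hsurj C t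
  exact (hproper C₁ C₂ x y ⟨A, f ≫ q, g ≫ q, hst⟩).map_eq H (f ≫ h) (g ≫ h)

/-! ### Finality -/

/-- A unique morphism from every coalgebra with free finitely generated carrier yields a unique
morphism from every coalgebra with finitely presentable carrier. -/
theorem nonempty_unique_of_isFinitelyPresentable {T : Monad (Type u)}
    (hT : PreservesFilteredColimits T.toFunctor) {F : T.Algebra ⥤ T.Algebra}
    (hsurj : PreservesSurjections F) (hproper : IsProper F) {R : Endofunctor.Coalgebra F}
    (H : ∀ C : FfgCoalgebra F, Nonempty (Unique (C.toCoalgebra ⟶ R)))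
    (A : Endofunctor.Coalgebra F) (hA : IsFinitelyPresentable.{u} A.V) :
    Nonempty (Unique (A ⟶ R)) := by
  obtain ⟨X, _, q, hq⟩ := exists_surjective_free hT A.V hA
  obtain ⟨c, f, rfl⟩ := exists_coalgebra_lift hsurj A X q hq
  have : Epi f.f := epi_of_surjective f.f hq
  have : Epi f := Endofunctor.Coalgebra.epi_of_epi f
  obtain ⟨u⟩ := H ⟨X, inferInstance, c⟩
  obtain ⟨k, hk⟩ := exists_desc_of_surjective f.f hq u.default.f
    (map_eq_of_map_eq hsurj hproper H _ f u.default)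
  refine ⟨⟨⟨⟨k, ?_⟩⟩, fun g => ?_⟩⟩
  · -- `k` is a coalgebra morphism because its composite with the epimorphism `f` is one
    rw [← cancel_epi f.f, ← f.h_assoc, ← F.map_comp, ← Category.assoc, hk]
    exact u.default.h
  · rw [← cancel_epi f]
    exact Subsingleton.elim _ _

/-- Morphisms out of a colimit are compatible families of morphisms, so having exactly one morphism
into `R` passes to colimits. -/
theorem nonempty_unique_of_isColimit {C : Type*} [Category* C] {J : Type*} [Category* J]
    {D : J ⥤ C} {c : Cocone D} (hc : IsColimit c) {R : C}
    (H : ∀ j, Nonempty (Unique (D.obj j ⟶ R))) : Nonempty (Unique (c.pt ⟶ R)) := by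
  have u := fun j => Classical.choice (H j)
  exact ⟨⟨⟨hc.desc ⟨R, { app := fun j => (u j).default
                         naturality := fun i _ _ =>
                           @Subsingleton.elim (D.obj i ⟶ R) _ _ _ }⟩⟩,
    fun g => hc.hom_ext fun j => Subsingleton.elim _ _⟩⟩

theorem corollary5p6 (T : Monad (Type u)) (hT : PreservesFilteredColimits T.toFunctor)
    (F : T.Algebra ⥤ T.Algebra) (hF : PreservesFilteredColimits F)
    (hsurj : PreservesSurjections F) (hproper : IsProper F) (R : Endofunctor.Coalgebra F) :
    IsFinalLocallyFp R ↔
      IsLocallyFp R ∧ ∀ C : FfgCoalgebra F, Nonempty (Unique (C.toCoalgebra ⟶ R)) := by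
  refine and_congr_right fun _ => ⟨fun h C => ?_, fun h A hA => ?_⟩
  · have := C.finite
    exact h _ (isLocallyFp_of_isFinitelyPresentable _ (isFinitelyPresentable_free hT C.X))
  · obtain ⟨J, _, _, D, ι, hD, ⟨hc⟩⟩ := hA
    exact nonempty_unique_of_isColimit hc fun j =>
      nonempty_unique_of_isFinitelyPresentable hT hsurj hproper h _ (hD j)
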